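/- Let $T,r_0>0$, $D\in\mathbb R$, and let $0<t_1^k<t_2^k<T$ ($k\in\mathbb N$) with $t_1^k\to 0$ and $t_2^k\to T$ as $k\to\infty$. For each $i\in\mathbb N$ let $U_T^i$ be a three-dimensional Riemannian region foliated by a solution $\Sigma_t^i$, $t\in[0,T]$, of inverse mean curvature flow $\partial_t F_i=\nu/H_i$ starting from a sphere; that is, in the coordinates $(x,t)\in S^2\times[0,T]$ given by the flow, $U_T^i=(S^2\times[0,T],\hat g^i)$ with $\Sigma^i_t=S^2\times\{t\}$ and $$\hat g^i=\frac{1}{H_i(x,t)^2}\,dt^2+g^i(x,t),$$ where $g^i(\cdot,t)$ is the induced metric of $\Sigma_t^i$, $\nu=H_i\partial_t$ its outward unit normal, $A^i$ its second fundamental form with respect to $\nu$, and $H_i=\operatorname{tr}_{g^i}A^i>0$ its mean curvature. The metric and $H_i$ are smooth for $0<t<T$, and the metrics $g^i(\cdot,t)$ extend continuously to Riemannian metrics at $t=0$ and $t=T$. Write $U_T^{i,k}=S^2\times[t_1^k,t_2^k]\subset U_T^i$. For a region or a leaf $U$, let $d_U$ denote its intrinsic distance, i.e. the infimum of the lengths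 of curves that stay in $U$; let $\sigma$ be the round metric of the unit sphere and $S^2(r)=(S^2,r^2\sigma)$ the round sphere of radius $r$. Assume: 1. $\operatorname{Diam}(\Sigma_t^i)\le D$ (intrinsic diameter) for all $i$ and all $t\in[0,T]$; 2. there is $h\in L^1([0,T])$ with $\dfrac1{H_i(x,t)}\le h(t)$ for all $i$, $x\in S^2$, $t\in(0,T)$; 3. $\displaystyle\liminf_{i\to\infty}d_{\Sigma_0^i}(\theta_1,\theta_2)\ge d_{S^2(r_0)}(\theta_1,\theta_2)$ for all $\theta_1,\theta_2\in S^2$; 4. for each fixed $k$ and $j=1,2$, the leaves $\Sigma^i_{t_j^k}$ converge in $C^0$ to $S^2(r_0e^{t_j^k/2})$, i.e. $g^i(\cdot,t_j^k)\to r_0^2e^{t_j^k}\sigma$ uniformly on $S^2$ as $i\to\infty$; 5. for some fixed $K\in\mathbb N$ and all $i$, $A^i(\cdot,\cdot)>0$ on $U_T^i\setminus(U_T^{i,K}\cup\partial U_T^i)$, i.e. on the leaves $\Sigma_t^i$ with $t\in(0,t_1^K)\cup(t_2^K,T)$. Then $$\lim_{k\to\infty}\ \limsup_{i\to\infty}\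 \sup_{p,q\in U_T^{i,k}}\bigl(d_{U_T^{i,k}}(p,q)-d_{U_T^i}(p,q)\bigr)=0 .$$ -/

import Mathlib

open Set Filter Topology MeasureTheory
open scoped RealInnerProductSpace ENNReal ContDiff

noncomputable section

namespace IMCF

/-- The space `ℝ³`, in which the parametrizing sphere `S²` is the unit sphere. -/
abbrev E3 : Type := EuclideanSpace ℝ (Fin 3)

/-- The space `ℝ³ × ℝ`, which contains `S² × [0,T]`. -/
abbrev Pt : Type := E3 × ℝ

/-- A field of bilinear forms on `ℝ³ × ℝ`. Only its values at points of `S² × [0,T]` on vectors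
tangent to `S² × ℝ` are meaningful; the rest is an auxiliary extension. -/
abbrev BilinField : Type := Pt → Pt →L[ℝ] Pt →L[ℝ] ℝ

/-- The unit sphere `S²`. -/
def S2 : Set E3 := Metric.sphere 0 1

/-- `U_a^b = {(x,t) : x ∈ S², a ≤ t ≤ b}`, the union of the leaves `Σ_t`, `t ∈ [a,b]`. -/
def region (a b : ℝ) : Set Pt := S2 ×ˢ Icc a b

/-- The leaf `Σ_t = S² × {t}`. -/
def leaf (t : ℝ) : Set Pt := S2 ×ˢ {t}

/-- `v` is tangent to `S² × ℝ` at `p = (x,t)`: its first component is orthogonal to `x`. -/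
def IsTangent (p v : Pt) : Prop := ⟪p.1, v.1⟫ = 0

/-- `v` is tangent at `p` to the leaf through `p`. -/
def IsLeafTangent (p v : Pt) : Prop := IsTangent p v ∧ v.2 = 0

/-- The restriction of a bilinear form to the directions of the leaves. -/
def leafForm (B : Pt →L[ℝ] Pt →L[ℝ] ℝ) : E3 →L[ℝ] E3 →L[ℝ] ℝ :=
  B.bilinearComp (ContinuousLinearMap.inl ℝ E3 ℝ) (ContinuousLinearMap.inl ℝ E3 ℝ)

/-- Length of a curve `γ : [0,1] → S² × [0,T]` with respect to `G`. -/
def length (G : BilinField) (γ : ℝ → Pt) : ℝ≥0∞ :=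
  ∫⁻ s in Icc (0 : ℝ) 1, ENNReal.ofReal √(G (γ s) (deriv γ s) (deriv γ s))

/-- The Lipschitz curves from `p` to `q` inside `U`. (On these regions and leaves they give the same
infimum of lengths as piecewise `C¹` curves.) -/
def curves (U : Set Pt) (p q : Pt) : Set (ℝ → Pt) :=
  {γ | (∃ C, LipschitzOnWith C γ (Icc 0 1)) ∧ MapsTo γ (Icc 0 1) U ∧ γ 0 = p ∧ γ 1 = q}

/-- The intrinsic (length) distance `d_U` of a subset `U`: the infimum of the `G`-lengths of the
curves from `p` to `q` that stay in `U`. For `U = leaf t` this is the Riemannian distance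
of `Σ_t` with its induced metric. -/
def dist (G : BilinField) (U : Set Pt) (p q : Pt) : ℝ≥0∞ :=
  ⨅ γ ∈ curves U p q, length G γ

/-- Diameter of `U` with respect to its intrinsic distance. -/
def diam (G : BilinField) (U : Set Pt) : ℝ≥0∞ :=
  ⨆ p ∈ U, ⨆ q ∈ U, dist G U p q

/-- The distance of the round sphere `S²(r)` of radius `r`, in terms of points of `S²`. -/
def roundDist (r : ℝ) (θ₁ θ₂ : E3) : ℝ≥0∞ :=
  ENNReal.ofReal (r * InnerProductGeometry.angle θ₁ θ₂)

/-- `G` is the metric of the region `S² × [0,T]`. It is smooth for `0 < t < T` and the induced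
metrics of the leaves extend continuously to the Riemannian metrics of `Σ_0` and `Σ_T`; nothing is
asked about the behaviour of the other components of `G` as `t → 0` or `t → T`, so that `H` may
tend to `0` or be unbounded there. (A smooth tensor on `S² × (0,T)` has a smooth extension
to `(ℝ³ \ {0}) × (0,T)`.) -/
structure IsRegionMetric (T : ℝ) (G : BilinField) : Prop where
  smooth : ContDiffOn ℝ ∞ G (({0}ᶜ : Set E3) ×ˢ Ioo 0 T)
  leaf_continuous : ContinuousOn (fun p => leafForm (G p)) (region 0 T)
  symm : ∀ p ∈ region 0 T, ∀ v w, IsTangent p v → IsTangent p w → G p v w = G p w v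
  pos : ∀ p ∈ region 0 T, ∀ v, IsTangent p v → v ≠ 0 → 0 < G p v v

/-- `n` is the unit normal at `p` of the leaf through `p`, pointing outward (to larger `t`). -/
def IsOutwardUnitNormal (G : BilinField) (p n : Pt) : Prop :=
  IsTangent p n ∧ (∀ v, IsLeafTangent p v → G p n v = 0) ∧ G p n n = 1 ∧ 0 < n.2

/-- The second fundamental form `A(v,w) = G(∇_v ν, w) = ½ (L_ν G)(v,w)`, for `v, w` tangent
to the leaf, of the leaves of a foliation with field of unit normals `ν`; the Lie derivative is
written in the linear coordinates of `ℝ³ × ℝ`. -/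
def secondFundamentalForm (G : BilinField) (ν : Pt → Pt) (p v w : Pt) : ℝ :=
  (fderiv ℝ G p (ν p) v w + G p (fderiv ℝ ν p v) w + G p v (fderiv ℝ ν p w)) / 2

/-- `c` is the mean curvature at `p` of the leaf through `p`: the trace of the second fundamental
form, computed in orthonormal bases of the tangent plane of the leaf. -/
def IsMeanCurvature (G : BilinField) (ν : Pt → Pt) (p : Pt) (c : ℝ) : Prop :=
  ∀ e₁ e₂, IsLeafTangent p e₁ → IsLeafTangent p e₂ →
    G p e₁ e₁ = 1 → G p e₂ e₂ = 1 → G p e₁ e₂ = 0 →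
    secondFundamentalForm G ν p e₁ e₁ + secondFundamentalForm G ν p e₂ e₂ = c

/-- The field `H ∂_t`. -/
def normalField (H : Pt → ℝ) (p : Pt) : Pt := H p • ((0 : E3), (1 : ℝ))

/-- `(S² × [0,T], G)` is a region foliated by a solution `Σ_t` of inverse mean curvature flow,
with mean curvature `H > 0`, in the coordinates `(x,t)` given by the flow map `F(x,t)`. In these
coordinates `∂F/∂t = ∂_t`, and the equation `∂F/∂t = ν / H` says that `ν = H ∂_t` is the outward
unit normal of the leaves, where `H` is their mean curvature. -/
structure IsSolution (T : ℝ) (G : BilinField) (H : Pt → ℝ) : Prop where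
  metric : IsRegionMetric T G
  smooth : ContDiffOn ℝ ∞ H (({0}ᶜ : Set E3) ×ˢ Ioo 0 T)
  pos : ∀ x ∈ S2, ∀ t ∈ Ioo 0 T, 0 < H (x, t)
  normal : ∀ x ∈ S2, ∀ t ∈ Ioo 0 T, IsOutwardUnitNormal G (x, t) (normalField H (x, t))
  mean : ∀ x ∈ S2, ∀ t ∈ Ioo 0 T, IsMeanCurvature G (normalField H) (x, t) (H (x, t))

/-- The second fundamental form of the leaf through `p` is positive definite. -/
def SecondFundamentalFormPos (G : BilinField) (H : Pt → ℝ) (p : Pt) : Prop :=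
  ∀ v, IsLeafTangent p v → v ≠ 0 → 0 < secondFundamentalForm G (normalField H) p v v

/-- The induced metrics of the leaves `Σ_t^i` converge in `C⁰`, as `i → ∞`, to the metric `r² σ` of
the round sphere `S²(r)`. -/
def LeafTendstoRound (G : ℕ → BilinField) (t r : ℝ) : Prop :=
  ∀ ε > 0, ∀ᶠ i in atTop, ∀ x ∈ S2, ∀ v : E3, ⟪x, v⟫ = 0 →
    |G i (x, t) (v, 0) (v, 0) - r ^ 2 * ‖v‖ ^ 2| ≤ ε * ‖v‖ ^ 2

/-- `sup_{p,q ∈ V} (d_V(p,q) - d_U(p,q))` for `V ⊆ U` (so that `d_U ≤ d_V`). -/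
def embeddingConstant (G : BilinField) (V U : Set Pt) : ℝ≥0∞ :=
  ⨆ p ∈ V, ⨆ q ∈ V, (dist G V p q - dist G U p q)

end IMCF

end

/-!
Only the leaves `Σ_t` with `t ∉ [a,b]` separate `V = S² × [a,b]` from `U = S² × [0,T]`. There
`A ≥ 0` and `tr A = H` give `0 ≤ A ≤ H g`, and since inverse mean curvature flow satisfies
`∂_t g = 2 A / H`, the leaf metrics obey `0 ≤ ∂_t g ≤ 2 g`. Hence the retraction of `U` onto `V`
along the flow lines stretches curves by at most `exp a`, so that
`d_V - d_U ≤ (exp a - 1) d_U ≤ (exp a - 1) diam U`, and `diam U` is bounded by twice the integral of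
`h` plus the diameter of a single leaf.
-/

section Calculus

theorem exists_ne_zero_common_zero {V : Type*} [AddCommGroup V] [Module ℝ V]
    [FiniteDimensional ℝ V] (hV : 2 < Module.finrank ℝ V) (φ ψ : V →ₗ[ℝ] ℝ) :
    ∃ w ≠ 0, φ w = 0 ∧ ψ w = 0 := by
  obtain ⟨w, hw, hw0⟩ := Submodule.exists_mem_ne_zero_of_ne_bot
    (LinearMap.ker_ne_bot_of_finrank_lt (f := φ.prod ψ) (by simpa using hV))
  exact ⟨w, hw0, Prod.mk_eq_zero.1 hw⟩

theorem inner_eq_zero_of_hasDerivAt_of_mem_sphere {F : Type*} [NormedAddCommGroup F]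
    [InnerProductSpace ℝ F] {γ : ℝ → F} {v : F} {r s : ℝ} (hγ : HasDerivAt γ v s)
    (hm : ∀ᶠ u in 𝓝 s, γ u ∈ Metric.sphere 0 r) : ⟪γ s, v⟫ = 0 := by
  have hconst : (fun u => ‖γ u‖ ^ 2) =ᶠ[𝓝 s] fun _ => r ^ 2 := by
    filter_upwards [hm] with u hu
    rw [mem_sphere_zero_iff_norm.1 hu]
  have h := hγ.norm_sq.unique ((hasDerivAt_const s (r ^ 2)).congr_of_eventuallyEq hconst)
  exact (mul_eq_zero.1 h).resolve_left two_ne_zero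

theorem hasDerivAt_eq_zero_of_notMem_Ioo {f : ℝ → ℝ} {f' a b s : ℝ} (hf : HasDerivAt f f' s)
    (hm : ∀ᶠ u in 𝓝 s, f u ∈ Icc a b) (hs : f s ∉ Ioo a b) : f' = 0 := by
  refine IsLocalExtr.hasDerivAt_eq_zero ?_ hf
  rcases le_or_gt (f s) a with hsa | hsa
  · exact Or.inl (hm.mono fun u hu => hsa.trans hu.1)
  · have hsb : b ≤ f s := not_lt.1 fun hsb => hs ⟨hsa, hsb⟩
    exact Or.inr (hm.mono fun u hu => hu.2.trans hsb)

theorem le_exp_mul_of_hasDerivAt_le {f f' : ℝ → ℝ} {a b c : ℝ} (hab : a ≤ b)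
    (hf : ContinuousOn f (Icc a b)) (hf' : ∀ t ∈ Ioo a b, HasDerivAt f (f' t) t)
    (hle : ∀ t ∈ Ioo a b, f' t ≤ c * f t) : f b ≤ Real.exp (c * (b - a)) * f a := by
  have hanti : AntitoneOn (fun t => Real.exp (-(c * t)) * f t) (Icc a b) := by
    refine antitoneOn_of_hasDerivWithinAt_nonpos
      (f' := fun t => Real.exp (-(c * t)) * (f' t - c * f t)) (convex_Icc a b)
      ((Continuous.continuousOn (by fun_prop)).mul hf) ?_ ?_ <;> rw [interior_Icc] <;> intro t ht
    · have hexp : HasDerivAt (fun s => Real.exp (-(c * s))) (Real.exp (-(c * t)) * -c) t := by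
        simpa using ((hasDerivAt_id t).const_mul c).neg.exp
      convert! (hexp.mul (hf' t ht)).hasDerivWithinAt using 1
      ring
    · exact mul_nonpos_of_nonneg_of_nonpos (Real.exp_pos _).le (sub_nonpos.2 (hle t ht))
  calc f b = Real.exp (c * b) * (Real.exp (-(c * b)) * f b) := by
        rw [← mul_assoc, ← Real.exp_add, add_neg_cancel, Real.exp_zero, one_mul]
    _ ≤ Real.exp (c * b) * (Real.exp (-(c * a)) * f a) :=
        mul_le_mul_of_nonneg_left (hanti (left_mem_Icc.2 hab) (right_mem_Icc.2 hab) hab)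
          (Real.exp_pos _).le
    _ = Real.exp (c * (b - a)) * f a := by
        rw [← mul_assoc, ← Real.exp_add, mul_sub, sub_eq_add_neg]

theorem ae_differentiableAt_of_lipschitzOnWith {F : Type*} [NormedAddCommGroup F] [NormedSpace ℝ F]
    [FiniteDimensional ℝ F] {γ : ℝ → F} {C : NNReal} {a b : ℝ}
    (hγ : LipschitzOnWith C γ (Icc a b)) :
    ∀ᵐ s ∂volume.restrict (Ioo a b), DifferentiableAt ℝ γ s := by
  rw [ae_restrict_iff' measurableSet_Ioo]
  filter_upwards [(hγ.mono Ioo_subset_Icc_self).ae_differentiableWithinAt_of_mem (μ := volume)]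
    with s hs hsI
  exact (hs hsI).differentiableAt (Ioo_mem_nhds hsI.1 hsI.2)

theorem setLIntegral_Icc_eq_add_Ioo (f : ℝ → ℝ≥0∞) {a b c : ℝ} (hab : a ≤ b) (hbc : b ≤ c) :
    ∫⁻ s in Icc a c, f s = (∫⁻ s in Ioo a b, f s) + ∫⁻ s in Ioo b c, f s := by
  rw [setLIntegral_congr Ioc_ae_eq_Icc.symm, ← Ioc_union_Ioc_eq_Ioc hab hbc,
    lintegral_union measurableSet_Ioc (Ioc_disjoint_Ioc_of_le le_rfl),
    setLIntegral_congr Ioo_ae_eq_Ioc, setLIntegral_congr Ioo_ae_eq_Ioc]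

end Calculus

namespace IMCF

/-- The coordinate field `∂_t`. -/
abbrev vertical : Pt := ((0 : E3), (1 : ℝ))

/-- The leaf through `p` is weakly convex at `p`: its second fundamental form is positive
semidefinite. -/
def SecondFundamentalFormNonneg (G : BilinField) (H : Pt → ℝ) (p : Pt) : Prop :=
  ∀ v, IsLeafTangent p v → 0 ≤ secondFundamentalForm G (normalField H) p v v

section SecondFundamentalForm

variable {G : BilinField} {H : Pt → ℝ} {ν : Pt → Pt} {p v w : Pt} {c : ℝ}

theorem IsLeafTangent.smul (hv : IsLeafTangent p v) (a : ℝ) : IsLeafTangent p (a • v) := by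
  obtain ⟨htan, hv2⟩ := hv
  unfold IsTangent at htan
  simp [IsLeafTangent, IsTangent, inner_smul_right, htan, hv2]

theorem exists_isLeafTangent_ne_zero_apply_eq_zero (φ : Pt →L[ℝ] ℝ) (p : Pt) :
    ∃ w ≠ 0, IsLeafTangent p w ∧ φ w = 0 := by
  obtain ⟨w, hw0, hwp, hwφ⟩ := exists_ne_zero_common_zero (V := E3) (by simp)
    (innerSL ℝ p.1).toLinearMap (φ.comp (ContinuousLinearMap.inl ℝ E3 ℝ)).toLinearMap
  exact ⟨(w, 0), by simpa using hw0, ⟨hwp, rfl⟩, hwφ⟩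

theorem secondFundamentalForm_smul_smul (G : BilinField) (ν : Pt → Pt) (p v : Pt) (a : ℝ) :
    secondFundamentalForm G ν p (a • v) (a • v) = a ^ 2 * secondFundamentalForm G ν p v v := by
  simp only [secondFundamentalForm, map_smul, smul_apply, smul_eq_mul]
  ring

theorem SecondFundamentalFormPos.nonneg (hA : SecondFundamentalFormPos G H p) :
    SecondFundamentalFormNonneg G H p := by
  intro v hv
  rcases eq_or_ne v 0 with rfl | hv0
  · simp [secondFundamentalForm]
  · exact (hA v hv hv0).le

theorem IsMeanCurvature.div_add_div_eq (hc : IsMeanCurvature G ν p c) (hv : IsLeafTangent p v)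
    (hw : IsLeafTangent p w) (hvv : 0 < G p v v) (hww : 0 < G p w w) (hvw : G p v w = 0) :
    secondFundamentalForm G ν p v v / G p v v + secondFundamentalForm G ν p w w / G p w w = c := by
  have sq_inv_sqrt {g : ℝ} (hg : 0 < g) : (√g)⁻¹ ^ 2 = g⁻¹ := by rw [inv_pow, Real.sq_sqrt hg.le]
  have unit {u : Pt} (hu : 0 < G p u u) :
      G p ((√(G p u u))⁻¹ • u) ((√(G p u u))⁻¹ • u) = 1 := by
    simp only [map_smul, smul_apply, smul_eq_mul]
    rw [← mul_assoc, ← sq, sq_inv_sqrt hu, inv_mul_cancel₀ hu.ne']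
  have htrace := hc _ _ (hv.smul (√(G p v v))⁻¹) (hw.smul (√(G p w w))⁻¹) (unit hvv) (unit hww)
    (by simp only [map_smul, smul_apply, smul_eq_mul, hvw, mul_zero])
  rwa [secondFundamentalForm_smul_smul, secondFundamentalForm_smul_smul, sq_inv_sqrt hvv,
    sq_inv_sqrt hww, ← div_eq_inv_mul, ← div_eq_inv_mul] at htrace

end SecondFundamentalForm

section LeafMetrics

variable {T a b t : ℝ} {G : BilinField} {H : Pt → ℝ} {x : E3}

theorem IsRegionMetric.apply_self_nonneg (hG : IsRegionMetric T G) {p v : Pt}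
    (hp : p ∈ region 0 T) (hv : IsTangent p v) : 0 ≤ G p v v := by
  rcases eq_or_ne v 0 with rfl | hv0
  · simp
  · exact (hG.pos p hp v hv hv0).le

theorem IsRegionMetric.continuousOn_leaf (hG : IsRegionMetric T G) (hx : x ∈ S2) (v : E3) :
    ContinuousOn (fun s => G (x, s) (v, 0) (v, 0)) (Icc 0 T) := by
  have hleaf : ContinuousOn (fun s : ℝ => leafForm (G (x, s))) (Icc 0 T) :=
    hG.leaf_continuous.comp (by fun_prop) fun s hs => ⟨hx, hs⟩
  exact (hleaf.clm_apply continuousOn_const).clm_apply continuousOn_const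

theorem mem_nhds_of_mem_S2 (hx : x ∈ S2) (ht : t ∈ Ioo 0 T) :
    (({0}ᶜ : Set E3) ×ˢ Ioo 0 T) ∈ 𝓝 ((x, t) : Pt) :=
  (isOpen_compl_singleton.prod isOpen_Ioo).mem_nhds
    ⟨ne_zero_of_mem_sphere one_ne_zero ⟨x, hx⟩, ht⟩

theorem IsRegionMetric.hasDerivAt (hG : IsRegionMetric T G) (hx : x ∈ S2) (ht : t ∈ Ioo 0 T)
    (v : Pt) : HasDerivAt (fun s => G (x, s) v v) (fderiv ℝ G (x, t) vertical v v) t := by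
  have hGd : HasFDerivAt G (fderiv ℝ G (x, t)) (x, t) :=
    ((hG.smooth.contDiffAt (mem_nhds_of_mem_S2 hx ht)).differentiableAt (by simp)).hasFDerivAt
  have hline : HasDerivAt (fun s : ℝ => ((x, s) : Pt)) vertical t :=
    (hasDerivAt_const t x).prodMk (hasDerivAt_id t)
  have hGline : HasDerivAt (fun s => G (x, s)) (fderiv ℝ G (x, t) vertical) t :=
    HasFDerivAt.comp_hasDerivAt (𝕜 := ℝ) (l := G) (f := fun s : ℝ => ((x, s) : Pt)) t hGd hline
  simpa using (hGline.clm_apply (hasDerivAt_const t v)).clm_apply (hasDerivAt_const t v)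

namespace IsSolution

variable (hs : IsSolution T G H)
include hs

theorem vertical_apply (hx : x ∈ S2) (ht : t ∈ Ioo 0 T) {v : Pt} (hv : IsLeafTangent (x, t) v) :
    G (x, t) vertical v = 0 := by
  have hν := (hs.normal x hx t ht).2.1 v hv
  simp only [normalField, map_smul, smul_apply, smul_eq_mul] at hν
  exact (mul_eq_zero.1 hν).resolve_left (hs.pos x hx t ht).ne'

theorem apply_vertical (hx : x ∈ S2) (ht : t ∈ Ioo 0 T) {v : Pt} (hv : IsLeafTangent (x, t) v) :
    G (x, t) v vertical = 0 := by
  rw [hs.metric.symm (x, t) ⟨hx, Ioo_subset_Icc_self ht⟩ v vertical hv.1 (by simp [IsTangent])]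
  exact hs.vertical_apply hx ht hv

theorem vertical_vertical (hx : x ∈ S2) (ht : t ∈ Ioo 0 T) :
    G (x, t) vertical vertical = (1 / H (x, t)) ^ 2 := by
  have hν := (hs.normal x hx t ht).2.2.1
  simp only [normalField, map_smul, smul_apply, smul_eq_mul] at hν
  have hH := hs.pos x hx t ht
  field_simp
  linarith

theorem apply_self_eq_leaf_add_sq (hx : x ∈ S2) (ht : t ∈ Ioo 0 T) {v : Pt}
    (hv : IsTangent (x, t) v) :
    G (x, t) v v = G (x, t) (v.1, 0) (v.1, 0) + (v.2 / H (x, t)) ^ 2 := by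
  have hleaf : IsLeafTangent (x, t) (v.1, 0) := ⟨hv, rfl⟩
  have hsplit : v = (v.1, 0) + v.2 • vertical := by simp
  conv_lhs => rw [hsplit]
  simp only [map_add, map_smul, add_apply, smul_apply, smul_eq_mul, hs.vertical_apply hx ht hleaf,
    hs.apply_vertical hx ht hleaf, hs.vertical_vertical hx ht]
  ring

theorem secondFundamentalForm_eq (hx : x ∈ S2) (ht : t ∈ Ioo 0 T) {v : Pt}
    (hv : IsLeafTangent (x, t) v) :
    secondFundamentalForm G (normalField H) (x, t) v v =
      H (x, t) * fderiv ℝ G (x, t) vertical v v / 2 := by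
  have hHd : DifferentiableAt ℝ H (x, t) :=
    (hs.smooth.contDiffAt (mem_nhds_of_mem_S2 hx ht)).differentiableAt (by simp)
  have hν : fderiv ℝ (normalField H) (x, t) v = (fderiv ℝ H (x, t) v) • vertical := by
    unfold normalField
    rw [fderiv_smul_const hHd]
    rfl
  simp only [secondFundamentalForm, hν, normalField, map_smul, smul_apply, smul_eq_mul,
    hs.vertical_apply hx ht hv, hs.apply_vertical hx ht hv]
  ring

theorem secondFundamentalForm_le (hx : x ∈ S2) (ht : t ∈ Ioo 0 T)
    (hA : SecondFundamentalFormNonneg G H (x, t)) {v : Pt} (hv : IsLeafTangent (x, t) v) :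
    secondFundamentalForm G (normalField H) (x, t) v v ≤ H (x, t) * G (x, t) v v := by
  rcases eq_or_ne v 0 with rfl | hv0
  · simp [secondFundamentalForm]
  obtain ⟨w, hw0, hw, hvw⟩ := exists_isLeafTangent_ne_zero_apply_eq_zero (G (x, t) v) (x, t)
  have hpos := hs.metric.pos (x, t) ⟨hx, Ioo_subset_Icc_self ht⟩
  have hvv := hpos v hv.1 hv0
  have hww := hpos w hw.1 hw0
  rw [← div_le_iff₀ hvv, ← (hs.mean x hx t ht).div_add_div_eq hv hw hvv hww hvw]
  exact le_add_of_nonneg_right (div_nonneg (hA w hw) hww.le)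

theorem fderiv_vertical_nonneg (hx : x ∈ S2) (ht : t ∈ Ioo 0 T)
    (hA : SecondFundamentalFormNonneg G H (x, t)) {v : Pt} (hv : IsLeafTangent (x, t) v) :
    0 ≤ fderiv ℝ G (x, t) vertical v v := by
  have hAv := hA v hv
  rw [hs.secondFundamentalForm_eq hx ht hv, mul_div_assoc] at hAv
  linarith [nonneg_of_mul_nonneg_right hAv (hs.pos x hx t ht)]

theorem fderiv_vertical_le (hx : x ∈ S2) (ht : t ∈ Ioo 0 T)
    (hA : SecondFundamentalFormNonneg G H (x, t)) {v : Pt} (hv : IsLeafTangent (x, t) v) :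
    fderiv ℝ G (x, t) vertical v v ≤ 2 * G (x, t) v v := by
  have hAv := hs.secondFundamentalForm_le hx ht hA hv
  rw [hs.secondFundamentalForm_eq hx ht hv, mul_div_assoc] at hAv
  linarith [le_of_mul_le_mul_left hAv (hs.pos x hx t ht)]

theorem leaf_le_leaf (ha : 0 ≤ a) (hab : a ≤ b) (hb : b ≤ T) (hx : x ∈ S2)
    (hA : ∀ t ∈ Ioo a b, SecondFundamentalFormNonneg G H (x, t)) {v : E3} (hv : ⟪x, v⟫ = 0) :
    G (x, a) (v, 0) (v, 0) ≤ G (x, b) (v, 0) (v, 0) := by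
  have hI : Ioo a b ⊆ Ioo 0 T := Ioo_subset_Ioo ha hb
  refine monotoneOn_of_hasDerivWithinAt_nonneg
    (f' := fun t => fderiv ℝ G (x, t) vertical (v, 0) (v, 0)) (convex_Icc a b)
    ((hs.metric.continuousOn_leaf hx v).mono (Icc_subset_Icc ha hb)) ?_ ?_
    (left_mem_Icc.2 hab) (right_mem_Icc.2 hab) hab <;> rw [interior_Icc] <;> intro t ht
  · exact (hs.metric.hasDerivAt hx (hI ht) _).hasDerivWithinAt
  · exact hs.fderiv_vertical_nonneg hx (hI ht) (hA t ht) ⟨hv, rfl⟩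

theorem leaf_le_exp_mul_leaf (ha : 0 ≤ a) (hab : a ≤ b) (hb : b ≤ T) (hx : x ∈ S2)
    (hA : ∀ t ∈ Ioo a b, SecondFundamentalFormNonneg G H (x, t)) {v : E3} (hv : ⟪x, v⟫ = 0) :
    G (x, b) (v, 0) (v, 0) ≤ Real.exp (2 * (b - a)) * G (x, a) (v, 0) (v, 0) := by
  have hI : Ioo a b ⊆ Ioo 0 T := Ioo_subset_Ioo ha hb
  exact le_exp_mul_of_hasDerivAt_le hab
    ((hs.metric.continuousOn_leaf hx v).mono (Icc_subset_Icc ha hb))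
    (fun t ht => hs.metric.hasDerivAt hx (hI ht) _)
    (fun t ht => hs.fderiv_vertical_le hx (hI ht) (hA t ht) ⟨hv, rfl⟩)

end IsSolution

end LeafMetrics

section Curves

/-- The integrand of `length`: the speed of `γ` with respect to `G`. -/
noncomputable def speed (G : BilinField) (γ : ℝ → Pt) (s : ℝ) : ℝ≥0∞ :=
  ENNReal.ofReal √(G (γ s) (deriv γ s) (deriv γ s))

theorem length_eq_setLIntegral_Ioo (G : BilinField) (γ : ℝ → Pt) :
    length G γ = ∫⁻ s in Ioo 0 1, speed G γ s :=
  setLIntegral_congr Ioo_ae_eq_Icc.symm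

theorem speed_comp_affine (G : BilinField) (γ : ℝ → Pt) (c d s : ℝ) :
    speed G (fun u => γ (c * u + d)) s = ENNReal.ofReal |c| * speed G γ (c * s + d) := by
  have hderiv : deriv (fun u => γ (c * u + d)) s = c • deriv γ (c * s + d) := by
    rw [deriv_comp_mul_left (f := fun u => γ (u + d)), deriv_comp_add_const]
  simp only [speed, hderiv, map_smul, smul_apply, smul_eq_mul]
  rw [← mul_assoc, Real.sqrt_mul (mul_self_nonneg c), Real.sqrt_mul_self_eq_abs,
    ENNReal.ofReal_mul (abs_nonneg c)]

theorem setLIntegral_speed_of_eqOn_comp_affine (G : BilinField) {γ η : ℝ → Pt} {c d : ℝ}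
    (hc : c ≠ 0) {S : Set ℝ} (hS : IsOpen S) (hη : EqOn η (fun u => γ (c * u + d)) S) :
    ∫⁻ s in S, speed G η s = ∫⁻ u in (fun s => c * s + d) '' S, speed G γ u := by
  rw [lintegral_image_eq_lintegral_abs_deriv_mul (f := fun s => c * s + d) (f' := fun _ => c)
    hS.measurableSet
    (fun s _ => by simpa using (((hasDerivAt_id s).const_mul c).add_const d).hasDerivWithinAt)
    (fun s _ u _ h => mul_left_cancel₀ hc (add_right_cancel h))]
  refine setLIntegral_congr_fun hS.measurableSet fun s hs => ?_
  rw [← speed_comp_affine, speed, speed, hη hs,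
    (hη.eventuallyEq_of_mem (hS.mem_nhds hs)).deriv_eq]

/-- The concatenation of two curves parametrized by `[0,1]`, of which the second starts at the end
of the first. Writing it as a sum makes it visibly Lipschitz. -/
def concat {E : Type*} [AddGroup E] (γ₁ γ₂ : ℝ → E) (s : ℝ) : E :=
  γ₁ (min (2 * s) 1) + (γ₂ (max (2 * s - 1) 0) - γ₂ 0)

theorem concat_of_le_half {E : Type*} [AddGroup E] (γ₁ γ₂ : ℝ → E) {s : ℝ} (hs : s ≤ 1 / 2) :
    concat γ₁ γ₂ s = γ₁ (2 * s) := by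
  rw [concat, min_eq_left (by linarith), max_eq_right (by linarith), sub_self, add_zero]

theorem concat_of_half_le {E : Type*} [AddCommGroup E] {γ₁ γ₂ : ℝ → E} (h : γ₁ 1 = γ₂ 0) {s : ℝ}
    (hs : 1 / 2 ≤ s) : concat γ₁ γ₂ s = γ₂ (2 * s - 1) := by
  rw [concat, min_eq_right (by linarith), max_eq_left (by linarith), h, add_sub_cancel]

theorem exists_lipschitzOnWith_concat {E : Type*} [SeminormedAddCommGroup E] {γ₁ γ₂ : ℝ → E}
    {C₁ C₂ : NNReal} (h₁ : LipschitzOnWith C₁ γ₁ (Icc 0 1))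
    (h₂ : LipschitzOnWith C₂ γ₂ (Icc 0 1)) :
    ∃ C, LipschitzOnWith C (concat γ₁ γ₂) (Icc 0 1) := by
  have hdouble : LipschitzWith ‖(2 : ℝ)‖₊ fun s : ℝ => 2 * s := lipschitzWith_smul (2 : ℝ)
  have hfirst := h₁.comp (hdouble.min_const 1).lipschitzOnWith (s := Icc 0 1) fun s hs =>
    ⟨le_min (by linarith [hs.1]) zero_le_one, min_le_right _ _⟩
  have hsecond := h₂.comp ((hdouble.sub (LipschitzWith.const 1)).max_const 0).lipschitzOnWith
    (s := Icc 0 1) fun s hs => ⟨le_max_right _ _, max_le (by linarith [hs.2]) zero_le_one⟩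
  exact ⟨_, hfirst.add (hsecond.sub (LipschitzWith.const (γ₂ 0)).lipschitzOnWith)⟩

theorem concat_mem_curves {U : Set Pt} {p m q : Pt} {γ₁ γ₂ : ℝ → Pt} (h₁ : γ₁ ∈ curves U p m)
    (h₂ : γ₂ ∈ curves U m q) : concat γ₁ γ₂ ∈ curves U p q := by
  obtain ⟨⟨C₁, hC₁⟩, hU₁, hp, hm₁⟩ := h₁
  obtain ⟨⟨C₂, hC₂⟩, hU₂, hm₂, hq⟩ := h₂
  have hjoin : γ₁ 1 = γ₂ 0 := hm₁.trans hm₂.symm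
  refine ⟨exists_lipschitzOnWith_concat hC₁ hC₂, fun s hs => ?_, ?_, ?_⟩
  · rcases le_total s (1 / 2) with h | h
    · rw [concat_of_le_half _ _ h]
      exact hU₁ ⟨by linarith [hs.1], by linarith⟩
    · rw [concat_of_half_le hjoin h]
      exact hU₂ ⟨by linarith, by linarith [hs.2]⟩
  · rw [concat_of_le_half _ _ (by norm_num), mul_zero, hp]
  · rw [concat_of_half_le hjoin (by norm_num), ← hq]
    norm_num

theorem length_concat (G : BilinField) {γ₁ γ₂ : ℝ → Pt} (h : γ₁ 1 = γ₂ 0) :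
    length G (concat γ₁ γ₂) = length G γ₁ + length G γ₂ := by
  have hfirst : ∫⁻ s in Ioo 0 (1 / 2), speed G (concat γ₁ γ₂) s = length G γ₁ := by
    rw [setLIntegral_speed_of_eqOn_comp_affine G (γ := γ₁) (d := 0) two_ne_zero isOpen_Ioo
      fun s hs => by simpa using concat_of_le_half γ₁ γ₂ hs.2.le, image_affine_Ioo two_pos,
      length_eq_setLIntegral_Ioo]
    norm_num
  have hsecond : ∫⁻ s in Ioo (1 / 2) 1, speed G (concat γ₁ γ₂) s = length G γ₂ := by
    rw [setLIntegral_speed_of_eqOn_comp_affine G (γ := γ₂) (d := -1) two_ne_zero isOpen_Ioo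
      fun s hs => concat_of_half_le h hs.1.le, image_affine_Ioo two_pos,
      length_eq_setLIntegral_Ioo]
    norm_num
  rw [← hfirst, ← hsecond]
  exact setLIntegral_Icc_eq_add_Ioo _ (by norm_num) (by norm_num)

theorem dist_triangle (G : BilinField) (U : Set Pt) (p m q : Pt) :
    dist G U p q ≤ dist G U p m + dist G U m q := by
  conv_rhs => unfold dist
  simp only [ENNReal.iInf_add, ENNReal.add_iInf]
  exact le_iInf₂ fun γ₂ h₂ => le_iInf₂ fun γ₁ h₁ => (iInf₂_le _ (concat_mem_curves h₁ h₂)).trans_eq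
    (length_concat G (h₁.2.2.2.trans h₂.2.2.1.symm))

theorem dist_le_of_subset (G : BilinField) {V U : Set Pt} (h : V ⊆ U) (p q : Pt) :
    dist G U p q ≤ dist G V p q :=
  le_iInf₂ fun γ hγ => iInf₂_le γ ⟨hγ.1, hγ.2.1.mono_right h, hγ.2.2⟩

theorem dist_le_diam (G : BilinField) {U : Set Pt} {p q : Pt} (hp : p ∈ U) (hq : q ∈ U) :
    dist G U p q ≤ diam G U :=
  (le_iSup₂ (f := fun q _ => dist G U p q) q hq).trans
    (le_iSup₂ (f := fun p _ => ⨆ q ∈ U, dist G U p q) p hp)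

end Curves

section Retraction

/-- The retraction of `S² × ℝ` onto `S² × [a,b]` along the vertical lines. -/
def clamp (a b : ℝ) (p : Pt) : Pt := (p.1, max a (min b p.2))

theorem lipschitzWith_clamp (a b : ℝ) : LipschitzWith 1 (clamp a b) := by
  simpa using! LipschitzWith.prod_fst.prodMk ((LipschitzWith.prod_snd.const_min b).const_max a)

theorem clamp_of_mem {a b : ℝ} {p : Pt} (hp : p.2 ∈ Icc a b) : clamp a b p = p := by
  simp [clamp, hp.1, hp.2]

theorem clamp_mem_region {a b : ℝ} (hab : a ≤ b) {p : Pt} (hp : p.1 ∈ S2) :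
    clamp a b p ∈ region a b :=
  ⟨hp, le_max_left _ _, max_le hab (min_le_left _ _)⟩

theorem clamp_comp_mem_curves {a b : ℝ} {U : Set Pt} (hU : ∀ p ∈ U, p.1 ∈ S2) {p q : Pt}
    (hp : p ∈ region a b) (hq : q ∈ region a b) {γ : ℝ → Pt} (hγ : γ ∈ curves U p q) :
    clamp a b ∘ γ ∈ curves (region a b) p q := by
  obtain ⟨⟨C, hC⟩, hm, h0, h1⟩ := hγ
  refine ⟨⟨1 * C, (lipschitzWith_clamp a b).comp_lipschitzOnWith hC⟩,
    fun s hs => clamp_mem_region (hp.2.1.trans hp.2.2) (hU _ (hm hs)), ?_, ?_⟩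
  · rw [Function.comp_apply, h0, clamp_of_mem hp.2]
  · rw [Function.comp_apply, h1, clamp_of_mem hq.2]

theorem isTangent_of_hasDerivAt {γ : ℝ → Pt} {s : ℝ} {v : Pt} (hγ : HasDerivAt γ v s)
    (hm : ∀ᶠ u in 𝓝 s, (γ u).1 ∈ S2) : IsTangent (γ s) v :=
  inner_eq_zero_of_hasDerivAt_of_mem_sphere hγ.fst hm

variable {T a b : ℝ} {G : BilinField} {H : Pt → ℝ}

namespace IsSolution

variable (hs : IsSolution T G H)
include hs

theorem leaf_clamp_le (ha : 0 ≤ a) (hab : a ≤ b) (hb : b ≤ T)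
    (hA : ∀ p ∈ S2 ×ˢ (Ioo 0 T \ Icc a b), SecondFundamentalFormNonneg G H p) {p : Pt}
    (hp : p ∈ region 0 T) {v : E3} (hv : ⟪p.1, v⟫ = 0) :
    G (clamp a b p) (v, 0) (v, 0) ≤ Real.exp (2 * a) * G p (v, 0) (v, 0) := by
  have hnonneg : 0 ≤ G p (v, 0) (v, 0) := hs.metric.apply_self_nonneg hp hv
  have hle_exp : G p (v, 0) (v, 0) ≤ Real.exp (2 * a) * G p (v, 0) (v, 0) :=
    le_mul_of_one_le_left hnonneg (Real.one_le_exp (by positivity))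
  obtain ⟨x, t⟩ := p
  obtain ⟨hx, h0, hT⟩ : x ∈ S2 ∧ 0 ≤ t ∧ t ≤ T := hp
  rcases le_or_gt t a with hta | hta
  · have hclamp : clamp a b (x, t) = (x, a) := by simp [clamp, hta]
    rw [hclamp]
    calc G (x, a) (v, 0) (v, 0) ≤ Real.exp (2 * (a - t)) * G (x, t) (v, 0) (v, 0) :=
          hs.leaf_le_exp_mul_leaf h0 hta (hab.trans hb) hx (fun u hu => hA (x, u)
            ⟨hx, ⟨h0.trans_lt hu.1, hu.2.trans_le (hab.trans hb)⟩, fun h => hu.2.not_ge h.1⟩) hv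
      _ ≤ Real.exp (2 * a) * G (x, t) (v, 0) (v, 0) := by gcongr; linarith
  rcases le_or_gt b t with hbt | hbt
  · have hclamp : clamp a b (x, t) = (x, b) := by simp [clamp, hbt, hab]
    rw [hclamp]
    exact (hs.leaf_le_leaf (ha.trans hab) hbt hT hx (fun u hu => hA (x, u)
      ⟨hx, ⟨(ha.trans hab).trans_lt hu.1, hu.2.trans_le hT⟩, fun h => hu.1.not_ge h.2⟩)
      hv).trans hle_exp
  · rwa [clamp_of_mem ⟨hta.le, hbt.le⟩]

theorem horizontal_le {γ : ℝ → Pt} {s : ℝ} {v : Pt} (hγ : HasDerivAt γ v s)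
    (hm : ∀ᶠ u in 𝓝 s, γ u ∈ region 0 T) : G (γ s) (v.1, 0) (v.1, 0) ≤ G (γ s) v v := by
  by_cases hmem : (γ s).2 ∈ Ioo 0 T
  · have htan : IsTangent (γ s) v := isTangent_of_hasDerivAt hγ (hm.mono fun u hu => hu.1)
    have hsplit := hs.apply_self_eq_leaf_add_sq (x := (γ s).1) (t := (γ s).2)
      hm.self_of_nhds.1 hmem htan
    exact (le_add_of_nonneg_right (sq_nonneg _)).trans_eq hsplit.symm
  · have hv : v.2 = 0 :=
      hasDerivAt_eq_zero_of_notMem_Ioo hγ.snd (hm.mono fun u hu => hu.2) hmem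
    rw [← hv]

theorem apply_deriv_clamp_comp_le (ha : 0 ≤ a) (hab : a ≤ b) (hb : b ≤ T)
    (hA : ∀ p ∈ S2 ×ˢ (Ioo 0 T \ Icc a b), SecondFundamentalFormNonneg G H p)
    {γ : ℝ → Pt} {s : ℝ} {v w : Pt} (hγ : HasDerivAt γ v s) (hcγ : HasDerivAt (clamp a b ∘ γ) w s)
    (hm : ∀ᶠ u in 𝓝 s, γ u ∈ region 0 T) :
    G (clamp a b (γ s)) w w ≤ Real.exp (2 * a) * G (γ s) v v := by
  have htan : IsTangent (γ s) v := isTangent_of_hasDerivAt hγ (hm.mono fun u hu => hu.1)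
  by_cases hmem : (γ s).2 ∈ Ioo a b
  · have heq : clamp a b ∘ γ =ᶠ[𝓝 s] γ := by
      filter_upwards [hγ.continuousAt.snd.eventually (Ioo_mem_nhds hmem.1 hmem.2)] with u hu
      exact clamp_of_mem (Ioo_subset_Icc_self hu)
    rw [clamp_of_mem (Ioo_subset_Icc_self hmem), hcγ.unique (hγ.congr_of_eventuallyEq heq)]
    exact le_mul_of_one_le_left (hs.metric.apply_self_nonneg hm.self_of_nhds htan)
      (Real.one_le_exp (by positivity))
  · -- The clamped curve sits on the boundary of `S² × [a,b]`, so its velocity is horizontal.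
    have hw : w = (v.1, 0) := by
      refine Prod.ext (HasDerivAt.unique (f := fun u => (γ u).1) hcγ.fst hγ.fst)
        (hasDerivAt_eq_zero_of_notMem_Ioo (a := a) (b := b) hcγ.snd
          (hm.mono fun u hu => (clamp_mem_region hab hu.1).2) fun h => hmem ?_)
      have hγs : (a < b ∧ a < (γ s).2) ∧ a < b ∧ (γ s).2 < b := by simpa [clamp, hab] using h
      exact ⟨hγs.1.2, hγs.2.2⟩
    rw [hw]
    exact (hs.leaf_clamp_le ha hab hb hA hm.self_of_nhds htan).trans
      (mul_le_mul_of_nonneg_left (hs.horizontal_le hγ hm) (Real.exp_pos _).le)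

theorem length_clamp_comp_le (ha : 0 ≤ a) (hab : a ≤ b) (hb : b ≤ T)
    (hA : ∀ p ∈ S2 ×ˢ (Ioo 0 T \ Icc a b), SecondFundamentalFormNonneg G H p)
    {p q : Pt} {γ : ℝ → Pt} (hγ : γ ∈ curves (region 0 T) p q) :
    length G (clamp a b ∘ γ) ≤ ENNReal.ofReal (Real.exp a) * length G γ := by
  obtain ⟨⟨C, hC⟩, hγm, -⟩ := hγ
  have hcC := (lipschitzWith_clamp a b).comp_lipschitzOnWith hC
  rw [length_eq_setLIntegral_Ioo, length_eq_setLIntegral_Ioo,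
    ← lintegral_const_mul' _ _ ENNReal.ofReal_ne_top]
  refine lintegral_mono_ae ?_
  filter_upwards [ae_differentiableAt_of_lipschitzOnWith hC,
    ae_differentiableAt_of_lipschitzOnWith hcC, ae_restrict_mem measurableSet_Ioo]
    with s hds hcds hsI
  have hm : ∀ᶠ u in 𝓝 s, γ u ∈ region 0 T :=
    eventually_of_mem (Icc_mem_nhds hsI.1 hsI.2) hγm
  have hsqrt : Real.exp a = √(Real.exp (2 * a)) := by
    rw [two_mul, Real.exp_add, Real.sqrt_mul_self (Real.exp_pos _).le]
  rw [speed, speed, ← ENNReal.ofReal_mul (Real.exp_pos _).le, hsqrt,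
    ← Real.sqrt_mul (Real.exp_pos _).le]
  exact ENNReal.ofReal_le_ofReal (Real.sqrt_le_sqrt
    (hs.apply_deriv_clamp_comp_le ha hab hb hA hds.hasDerivAt hcds.hasDerivAt hm))

theorem dist_region_le_exp_mul (ha : 0 ≤ a) (hb : b ≤ T)
    (hA : ∀ p ∈ S2 ×ˢ (Ioo 0 T \ Icc a b), SecondFundamentalFormNonneg G H p)
    {p q : Pt} (hp : p ∈ region a b) (hq : q ∈ region a b) :
    dist G (region a b) p q ≤ ENNReal.ofReal (Real.exp a) * dist G (region 0 T) p q := by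
  have hexp : ENNReal.ofReal (Real.exp a) ≠ 0 := by simp [Real.exp_pos]
  conv_rhs => unfold dist
  simp only [ENNReal.mul_iInf_of_ne hexp ENNReal.ofReal_ne_top]
  exact le_iInf₂ fun γ hγ => (iInf₂_le _ (clamp_comp_mem_curves (fun _ h => h.1) hp hq hγ)).trans
    (hs.length_clamp_comp_le ha (hp.2.1.trans hp.2.2) hb hA hγ)

theorem embeddingConstant_le (ha : 0 ≤ a) (hb : b ≤ T)
    (hA : ∀ p ∈ S2 ×ˢ (Ioo 0 T \ Icc a b), SecondFundamentalFormNonneg G H p) :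
    embeddingConstant G (region a b) (region 0 T) ≤
      ENNReal.ofReal (Real.exp a - 1) * diam G (region 0 T) := by
  have hsub : region a b ⊆ region 0 T := prod_mono le_rfl (Icc_subset_Icc ha hb)
  have hexp : ENNReal.ofReal (Real.exp a) = ENNReal.ofReal (Real.exp a - 1) + 1 := by
    rw [← ENNReal.ofReal_one,
      ← ENNReal.ofReal_add (sub_nonneg.2 (Real.one_le_exp ha)) zero_le_one, sub_add_cancel]
  refine iSup₂_le fun p hp => iSup₂_le fun q hq => tsub_le_iff_right.2 ?_
  calc dist G (region a b) p q
      ≤ ENNReal.ofReal (Real.exp a) * dist G (region 0 T) p q :=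
        hs.dist_region_le_exp_mul ha hb hA hp hq
    _ = ENNReal.ofReal (Real.exp a - 1) * dist G (region 0 T) p q + dist G (region 0 T) p q := by
        rw [hexp, add_mul, one_mul]
    _ ≤ ENNReal.ofReal (Real.exp a - 1) * diam G (region 0 T) + dist G (region 0 T) p q := by
        gcongr
        exact dist_le_diam G (hsub hp) (hsub hq)

end IsSolution

end Retraction

section Diameter

variable {T t τ : ℝ} {G : BilinField} {H : Pt → ℝ} {x : E3} {h : ℝ → ℝ}

theorem vertical_segment_mem_curves (hx : x ∈ S2) (ht : t ∈ Icc 0 T) (hτ : τ ∈ Icc 0 T) :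
    (fun s => (x, AffineMap.lineMap t τ s)) ∈ curves (region 0 T) (x, t) (x, τ) :=
  ⟨⟨_, ((LipschitzWith.const x).prodMk (lipschitzWith_lineMap t τ)).lipschitzOnWith⟩,
    fun _ hs => ⟨hx, (convex_Icc 0 T).lineMap_mem ht hτ hs⟩, by simp, by simp⟩

namespace IsSolution

variable (hs : IsSolution T G H)
include hs

theorem speed_vertical_line (hx : x ∈ S2) (ht : t ∈ Ioo 0 T) :
    speed G (fun u => (x, u)) t = ENNReal.ofReal (1 / H (x, t)) := by
  have hderiv : deriv (fun u : ℝ => ((x, u) : Pt)) t = vertical :=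
    ((hasDerivAt_const t x).prodMk (hasDerivAt_id t)).deriv
  rw [speed, hderiv, hs.vertical_vertical hx ht,
    Real.sqrt_sq (one_div_nonneg.2 (hs.pos x hx t ht).le)]

theorem length_vertical_segment_le (hH : ∀ x ∈ S2, ∀ t ∈ Ioo 0 T, 1 / H (x, t) ≤ h t)
    (hx : x ∈ S2) (ht : t ∈ Icc 0 T) (hτ : τ ∈ Icc 0 T) :
    length G (fun s => (x, AffineMap.lineMap t τ s)) ≤ ∫⁻ u in Icc 0 T, ENNReal.ofReal (h u) := by
  rcases eq_or_ne t τ with rfl | hne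
  · simp [length]
  have hline : (fun s => (τ - t) * s + t) = AffineMap.lineMap t τ := by
    ext s
    rw [AffineMap.lineMap_apply_ring', mul_comm]
  have himage : (fun s => (τ - t) * s + t) '' Ioo 0 1 ⊆ Ioo 0 T := by
    rw [hline, ← openSegment_eq_image_lineMap, ← interior_Icc]
    exact (strictConvex_Icc (𝕜 := ℝ) 0 T).openSegment_subset ht hτ hne
  calc length G (fun s => (x, AffineMap.lineMap t τ s))
      = ∫⁻ u in (fun s => (τ - t) * s + t) '' Ioo 0 1, speed G (fun u => (x, u)) u := by
        rw [length_eq_setLIntegral_Ioo]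
        exact setLIntegral_speed_of_eqOn_comp_affine G (sub_ne_zero.2 hne.symm) isOpen_Ioo
          fun s _ => congrArg (Prod.mk x) (congrFun hline s).symm
    _ ≤ ∫⁻ u in Ioo 0 T, speed G (fun u => (x, u)) u := lintegral_mono_set himage
    _ ≤ ∫⁻ u in Ioo 0 T, ENNReal.ofReal (h u) := setLIntegral_mono' measurableSet_Ioo fun u hu =>
        (hs.speed_vertical_line hx hu).trans_le (ENNReal.ofReal_le_ofReal (hH x hx u hu))
    _ ≤ ∫⁻ u in Icc 0 T, ENNReal.ofReal (h u) := lintegral_mono_set Ioo_subset_Icc_self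

theorem diam_region_le (hH : ∀ x ∈ S2, ∀ t ∈ Ioo 0 T, 1 / H (x, t) ≤ h t) (ht : t ∈ Icc 0 T) :
    diam G (region 0 T) ≤ 2 * (∫⁻ u in Icc 0 T, ENNReal.ofReal (h u)) + diam G (leaf t) := by
  have hvert {x : E3} {t τ : ℝ} (hx : x ∈ S2) (ht : t ∈ Icc 0 T) (hτ : τ ∈ Icc 0 T) :
      dist G (region 0 T) (x, t) (x, τ) ≤ ∫⁻ u in Icc 0 T, ENNReal.ofReal (h u) :=
    (iInf₂_le _ (vertical_segment_mem_curves hx ht hτ)).trans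
      (hs.length_vertical_segment_le hH hx ht hτ)
  have hleaf {x y : E3} (hx : x ∈ S2) (hy : y ∈ S2) :
      dist G (region 0 T) (x, t) (y, t) ≤ diam G (leaf t) :=
    (dist_le_of_subset G (prod_mono le_rfl (singleton_subset_iff.2 ht)) _ _).trans
      (dist_le_diam G ⟨hx, rfl⟩ ⟨hy, rfl⟩)
  refine iSup₂_le fun p hp => iSup₂_le fun q hq => ?_
  calc dist G (region 0 T) p q
      ≤ dist G (region 0 T) p (p.1, t) +
          (dist G (region 0 T) (p.1, t) (q.1, t) + dist G (region 0 T) (q.1, t) q) :=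
        (dist_triangle G _ _ _ _).trans (add_le_add le_rfl (dist_triangle G _ _ _ _))
    _ ≤ (∫⁻ u in Icc 0 T, ENNReal.ofReal (h u)) +
          (diam G (leaf t) + ∫⁻ u in Icc 0 T, ENNReal.ofReal (h u)) :=
        add_le_add (hvert hp.1 hp.2 ht) (add_le_add (hleaf hp.1 hq.1) (hvert hq.1 ht hq.2))
    _ = _ := by ring

end IsSolution

end Diameter

theorem region_diff_eq (T a b : ℝ) :
    region 0 T \ (region a b ∪ (leaf 0 ∪ leaf T)) = S2 ×ˢ (Ioo 0 T \ Icc a b) := by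
  ext ⟨x, t⟩
  simp only [region, leaf, Set.mem_sdiff, mem_union, mem_prod, mem_Icc, mem_Ioo, mem_singleton_iff]
  grind

end IMCF

open IMCF in
theorem lemma3p8_general {ι κ : Type*} {l : Filter κ} {T D a₀ b₀ : ℝ} (ha₀ : 0 < a₀) (hb₀ : b₀ < T)
    {t₁ t₂ : κ → ℝ} (ht₁_nonneg : ∀ k, 0 ≤ t₁ k) (ht₂_le : ∀ k, t₂ k ≤ T)
    (ht₁ : Tendsto t₁ l (𝓝 0)) (ht₂ : Tendsto t₂ l (𝓝 T))
    {G : ι → BilinField} {H : ι → Pt → ℝ} (hsol : ∀ i, IsSolution T (G i) (H i))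
    (hdiam : ∀ i, ∃ t ∈ Icc 0 T, IMCF.diam (G i) (leaf t) ≤ ENNReal.ofReal D)
    {h : ℝ → ℝ} (h_int : IntegrableOn h (Icc 0 T))
    (hH : ∀ i, ∀ x ∈ S2, ∀ t ∈ Ioo 0 T, 1 / H i (x, t) ≤ h t)
    (hconv : ∀ i, ∀ p ∈ S2 ×ˢ (Ioo 0 T \ Icc a₀ b₀), SecondFundamentalFormNonneg (G i) (H i) p) :
    Tendsto (fun k => ⨆ i, embeddingConstant (G i) (region (t₁ k) (t₂ k)) (region 0 T)) l
      (𝓝 0) := by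
  set M : ℝ≥0∞ := 2 * (∫⁻ s in Icc 0 T, ENNReal.ofReal (h s)) + ENNReal.ofReal D
  have hM : M ≠ ⊤ := by finiteness [h_int.lintegral_lt_top.ne]
  have hdiamU (i : ι) : IMCF.diam (G i) (region 0 T) ≤ M := by
    obtain ⟨t, ht, htD⟩ := hdiam i
    exact ((hsol i).diam_region_le (hH i) ht).trans (add_le_add le_rfl htD)
  have hbound : Tendsto (fun k => ENNReal.ofReal (Real.exp (t₁ k) - 1) * M) l (𝓝 0) := by
    have hexp : Tendsto (fun k => Real.exp (t₁ k) - 1) l (𝓝 0) := by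
      simpa using ((Real.continuous_exp.tendsto 0).comp ht₁).sub_const 1
    simpa using ENNReal.Tendsto.mul_const (ENNReal.tendsto_ofReal hexp) (Or.inr hM)
  refine tendsto_of_tendsto_of_tendsto_of_le_of_le' tendsto_const_nhds hbound
    (Eventually.of_forall fun _ => zero_le) ?_
  filter_upwards [ht₁.eventually_lt_const ha₀, ht₂.eventually_const_lt hb₀] with k hk₁ hk₂
  refine iSup_le fun i => ((hsol i).embeddingConstant_le (ht₁_nonneg k) (ht₂_le k) fun p hp =>
    hconv i p ⟨hp.1, hp.2.1, fun hmem => hp.2.2 ?_⟩).trans (mul_le_mul_right (hdiamU i) _)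
  exact Icc_subset_Icc hk₁.le hk₂.le hmem

theorem lemma3p8
    (T r₀ D : ℝ) (hr₀ : 0 < r₀)
    (t₁ t₂ : ℕ → ℝ)
    (ht₁_pos : ∀ k, 0 < t₁ k) (ht₁₂ : ∀ k, t₁ k < t₂ k) (ht₂_lt : ∀ k, t₂ k < T)
    (ht₁ : Tendsto t₁ atTop (𝓝 0)) (ht₂ : Tendsto t₂ atTop (𝓝 T))
    (G : ℕ → IMCF.BilinField) (H : ℕ → IMCF.Pt → ℝ)
    (hsol : ∀ i, IMCF.IsSolution T (G i) (H i))
    (hdiam : ∀ i, ∀ t ∈ Icc 0 T, IMCF.diam (G i) (IMCF.leaf t) ≤ ENNReal.ofReal D)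
    (h : ℝ → ℝ) (h_int : IntegrableOn h (Icc 0 T))
    (hH : ∀ i, ∀ x ∈ IMCF.S2, ∀ t ∈ Ioo 0 T, 1 / H i (x, t) ≤ h t)
    (hdist : ∀ θ₁ ∈ IMCF.S2, ∀ θ₂ ∈ IMCF.S2,
      IMCF.roundDist r₀ θ₁ θ₂ ≤
        liminf (fun i => IMCF.dist (G i) (IMCF.leaf 0) (θ₁, 0) (θ₂, 0)) atTop)
    (hC0₁ : ∀ k, IMCF.LeafTendstoRound G (t₁ k) (r₀ * Real.exp (t₁ k / 2)))
    (hC0₂ : ∀ k, IMCF.LeafTendstoRound G (t₂ k) (r₀ * Real.exp (t₂ k / 2)))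
    (K : ℕ)
    (hconv : ∀ i, ∀ p ∈ IMCF.region 0 T \
        (IMCF.region (t₁ K) (t₂ K) ∪ (IMCF.leaf 0 ∪ IMCF.leaf T)),
      IMCF.SecondFundamentalFormPos (G i) (H i) p) :
    Tendsto
      (fun k => limsup
        (fun i => IMCF.embeddingConstant (G i) (IMCF.region (t₁ k) (t₂ k)) (IMCF.region 0 T))
        atTop)
      atTop (𝓝 0) := by
  have hT : 0 ≤ T := ((ht₁_pos 0).trans ((ht₁₂ 0).trans (ht₂_lt 0))).le
  exact tendsto_of_tendsto_of_tendsto_of_le_of_le tendsto_const_nhds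
    (lemma3p8_general (ht₁_pos K) (ht₂_lt K) (fun k => (ht₁_pos k).le) (fun k => (ht₂_lt k).le)
      ht₁ ht₂ hsol (fun i => ⟨0, left_mem_Icc.2 hT, hdiam i 0 (left_mem_Icc.2 hT)⟩) h_int hH
      fun i p hp => (hconv i p (by rwa [IMCF.region_diff_eq])).nonneg)
    (fun _ => zero_le) fun _ => limsup_le_iSup
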